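/- **Proposition.** Let $k\in\mathbb{Z}$, let $\chi$, $\delta$, $\epsilon$ be Dirichlet characters modulo positive integers $N$, $D$, $E$ (not necessarily primitive), and let $M_k(\chi)$ be the space of modular forms of weight $k$ for $\Gamma_0(N)$ and $\chi$. For $f\in M_k(\chi)$ with Fourier expansion $f(\tau)=\sum_{n\ge 0}c(n)e^{2\pi i n\tau}$ and $w\in\mathbb{C}$ put $$\sigma_{w,\delta,\epsilon}(n)=\sum_{0<d\mid n}\delta(d)\,\epsilon(n/d)\,d^w,\qquad L(f\times\psi,s)=\sum_{n\ge1}\psi(n)c(n)n^{-s}\ \ (\psi=\delta,\epsilon),\qquad L(\chi\delta\epsilon,s)=\sum_{n\ge1}\chi(n)\delta(n)\epsilon(n)n^{-s}.$$ Call $f$ a normalized eigenform if $c(1)=1$ and $f$ is an eigenfunction of all Hecke operators $T_n$, $n\ge1$, on $M_k(\chi)$ (with $T_p=U_p$ for primes $p\mid N$), and a newform if it is in addition a cusp form that is orthogonal, for the Petersson product, to all oldforms of level $N$ and character $\chi$. (i) If $f$ is a newform, then for all $s,w\in\mathbb{C}$ with $\operatorname{Re}s>\operatorname{Re}w+\frac{k+3}{2}$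 and $\operatorname{Re}s>\frac{k+1}{2}$ (the second condition follows from the first if $\operatorname{Re}w\ge-1$), the following series and $L$-series converge absolutely, $L(\chi\delta\epsilon,2s-w+1-k)\neq0$, and $$\sum_{n=1}^\infty\sigma_{w,\delta,\epsilon}(n)\,c(n)\,n^{-s}=\frac{L(f\times\epsilon,s)\,L(f\times\delta,s-w)}{L(\chi\delta\epsilon,2s-w+1-k)}.$$ (ii) If $f$ is any normalized eigenform in $M_k(\chi)$, cuspidal or not, the same holds for all $s,w\in\mathbb{C}$ with $\operatorname{Re}s>\operatorname{Re}w+k+1$ and $\operatorname{Re}s>k+1$. -/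

import Mathlib

open scoped MatrixGroups ModularForm

noncomputable section

namespace RankinConvolution

open UpperHalfPlane CongruenceSubgroup

/-- `Γ₁(N)`, viewed inside `GL₂(ℝ)`. -/
abbrev Γ₁ (N : ℕ) : Subgroup (GL (Fin 2) ℝ) := (Gamma1 N : Subgroup (GL (Fin 2) ℝ))

/-- `M_k(χ)` for a Dirichlet character `χ` mod `N`: the modular forms `f` of weight `k` (holomorphic
on `ℍ`, bounded at all cusps) with `(cτ + d)⁻ᵏ f(γτ) = χ(d) f(τ)` for all `γ = (a b; c d) ∈ Γ₀(N)`.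
Invariance under `Γ₁(N)`, required by the ambient type, is a special case of that condition. -/
def modularForms {N : ℕ} (k : ℤ) (χ : DirichletCharacter ℂ N) :
    Submodule ℂ (ModularForm (Γ₁ N) k) where
  carrier := {f | ∀ γ : SL(2, ℤ), γ ∈ Gamma0 N → ⇑f ∣[k] γ = χ ((γ 1 1 : ℤ) : ZMod N) • ⇑f}
  add_mem' {f g} hf hg γ hγ := by
    rw [FunLike.coe_add, SlashAction.add_slash, hf γ hγ, hg γ hγ, smul_add]
  zero_mem' γ _ := by
    rw [FunLike.coe_zero, SlashAction.zero_slash, smul_zero]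
  smul_mem' a f hf γ hγ := by
    rw [FunLike.coe_smul, ModularForm.SL_smul_slash, hf γ hγ, smul_comm]

/-- `S_k(χ)`: the cusp forms in `M_k(χ)`. -/
def cuspForms {N : ℕ} (k : ℤ) (χ : DirichletCharacter ℂ N) :
    Submodule ℂ (ModularForm (Γ₁ N) k) :=
  modularForms k χ ⊓ ModularForm.cuspFormSubmodule (Γ₁ N) k

/-- The `n`-th Fourier coefficient `c(n)` of `f(τ) = ∑ c(n) exp(2πinτ)`. -/
def coeff {N : ℕ} {k : ℤ} (f : ModularForm (Γ₁ N) k) (n : ℕ) : ℂ :=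
  (qExpansion 1 f).coeff n

/-- The classical Hecke operator `T_n` (`n ≥ 1`) in weight `k` and character `χ`:
`(T_n f)(τ) = n^(k-1) ∑_{ad = n} χ(a) d^(-k) ∑_{0 ≤ b < d} f((aτ + b)/d)`.
For a prime `n` dividing the modulus of `χ` this is the operator `U_n`. -/
def heckeT {N : ℕ} (k : ℤ) (χ : DirichletCharacter ℂ N) (n : ℕ) (f : ℍ → ℂ) : ℍ → ℂ := fun τ ↦
  (n : ℂ) ^ (k - 1) * ∑ ad ∈ n.divisorsAntidiagonal,
    χ (ad.1 : ZMod N) * (ad.2 : ℂ) ^ (-k) *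
      ∑ b ∈ Finset.range ad.2, f (ofComplex (((ad.1 : ℂ) * τ + b) / ad.2))

/-- `f ∈ M_k(χ)` is an eigenfunction of all Hecke operators `T_n`, `n ≥ 1`, and `c(1) = 1`. -/
structure IsNormalizedEigenform {N : ℕ} {k : ℤ} (χ : DirichletCharacter ℂ N)
    (f : ModularForm (Γ₁ N) k) : Prop where
  mem : f ∈ modularForms k χ
  eigen : ∀ n : ℕ, 1 ≤ n → ∃ a : ℂ, heckeT k χ n f = a • ⇑f
  normalized : coeff f 1 = 1

/-- The space `S_k^old(χ)` of oldforms of level `N` and character `χ`: the span of all `g(dτ)` with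
`g ∈ S_k(χ')` for a character `χ'` modulo a proper divisor `M` of `N` that induces `χ`, and
`d ∣ N / M`. -/
def oldforms {N : ℕ} (k : ℤ) (χ : DirichletCharacter ℂ N) : Submodule ℂ (ℍ → ℂ) :=
  Submodule.span ℂ {h | ∃ (M d : ℕ) (hM : M ∣ N) (χ' : DirichletCharacter ℂ M)
    (g : ModularForm (Γ₁ M) k), M ≠ N ∧ d * M ∣ N ∧
      DirichletCharacter.changeLevel hM χ' = χ ∧ g ∈ cuspForms k χ' ∧
      h = fun τ : ℍ ↦ g (ofComplex ((d : ℂ) * τ))}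

/-- The Petersson product
`∫_{Γ₀(N)\ℍ} conj (f(τ)) g(τ) y^k dx dy / y²` of two forms of the same weight and character; the
domain of integration is cut into the translates, under representatives of `Γ₀(N)\SL₂(ℤ)`, of the
standard fundamental domain of `SL₂(ℤ)`. -/
def peterssonInner (N : ℕ) (k : ℤ) (f g : ℍ → ℂ) : ℂ :=
  ∫ τ in ModularGroup.fd, ∑ᶠ q : SL(2, ℤ) ⧸ Gamma0 N, petersson k f g (q.out⁻¹ • τ)

/-- `f` is a newform of level `N` and character `χ`: a normalized cuspidal eigenform of all Hecke
operators that is orthogonal to the oldforms. -/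
structure IsNewform {N : ℕ} {k : ℤ} (χ : DirichletCharacter ℂ N)
    (f : ModularForm (Γ₁ N) k) : Prop extends IsNormalizedEigenform χ f where
  cuspidal : f ∈ cuspForms k χ
  new : ∀ h ∈ oldforms k χ, peterssonInner N k h f = 0

/-- The twisted divisor sum `σ_{w,δ,ε}(n) = ∑_{d ∣ n} δ(d) ε(n/d) d^w`. -/
def sigma {D E : ℕ} (w : ℂ) (δ : DirichletCharacter ℂ D) (ε : DirichletCharacter ℂ E) (n : ℕ) : ℂ :=
  ∑ d ∈ n.divisors, δ (d : ZMod D) * ε ((n / d : ℕ) : ZMod E) * (d : ℂ) ^ w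

/-- The coefficients of the Dirichlet series `L(f × ψ, s) = ∑ ψ(n) c(n) n^(-s)`. -/
def twistCoeff {N D : ℕ} {k : ℤ} (f : ModularForm (Γ₁ N) k) (ψ : DirichletCharacter ℂ D)
    (n : ℕ) : ℂ :=
  ψ (n : ZMod D) * coeff f n

/-- The values at natural numbers of the product Dirichlet character `χδε`, whose modulus is the
least common multiple of the three moduli. -/
def prodChar {N D E : ℕ} (χ : DirichletCharacter ℂ N) (δ : DirichletCharacter ℂ D)
    (ε : DirichletCharacter ℂ E) (n : ℕ) : ℂ :=
  (χ.mul δ).mul ε (n : ZMod ((N.lcm D).lcm E))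

/-- All three `L`-series at the indicated points converge absolutely, the one in the denominator
does not vanish, and the series `∑ σ_{w,δ,ε}(n) c(n) n^(-s)` converges absolutely with sum
`L(f × ε, s) L(f × δ, s - w) / L(χδε, 2s - w + 1 - k)`. -/
structure ProductDecomposition {N D E : ℕ} {k : ℤ} (χ : DirichletCharacter ℂ N)
    (f : ModularForm (Γ₁ N) k) (δ : DirichletCharacter ℂ D) (ε : DirichletCharacter ℂ E)
    (s w : ℂ) : Prop where
  summable_left : LSeriesSummable (twistCoeff f ε) s
  summable_right : LSeriesSummable (twistCoeff f δ) (s - w)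
  summable_denom : LSeriesSummable (prodChar χ δ ε) (2 * s - w + 1 - k)
  denom_ne_zero : LSeries (prodChar χ δ ε) (2 * s - w + 1 - k) ≠ 0
  hasSum : LSeriesHasSum (fun n ↦ sigma w δ ε n * coeff f n) s
    (LSeries (twistCoeff f ε) s * LSeries (twistCoeff f δ) (s - w) /
      LSeries (prodChar χ δ ε) (2 * s - w + 1 - k))

end RankinConvolution

end

/-!
The Hecke operators act on Fourier expansions by
`T_m : c(n) ↦ ∑_{d ∣ (m, n)} χ(d) d^(k - 1) c(mn / d²)` (`hasSum_heckeT`), so for a normalized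
eigenform the eigenvalue of `T_m` is `c(m)` and
`c(m) c(n) = ∑_{d ∣ (m, n)} χ(d) d^(k - 1) c(mn / d²)`
(`IsNormalizedEigenform.heckeRelation`).

Insert this relation into `L(f × ε, s) L(f × δ, s - w) = ∑_{m, n} α(m) β(n) c(m) c(n)`, where
`α(m) = ε(m) m^(-s)` and `β(n) = δ(n) n^(w - s)`. Writing `m = d m'` and `n = d n'`, the sum over
`d` splits off as `∑_d χ(d) d^(k - 1) α(d) β(d) = L(χδε, 2s - w + 1 - k)`, and what is left is
`∑_{m', n'} α(m') β(n') c(m' n')`, which is `∑ σ_{w,δ,ε}(n) c(n) n^(-s)` after collecting the terms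
with `m' n' = n`. No Euler product is needed, and primes dividing the levels play no special role.
The double series converges absolutely because Möbius inversion of the Hecke relations expresses
`c(mn)` through products of coefficients (`HeckeRelation.apply_mul`). Thus the identity holds
wherever the three `L`-series on the right converge absolutely (`HeckeRelation.exists_hasSum`,
`IsNormalizedEigenform.productDecomposition`).

It remains to bound the coefficients. The weight is nonnegative since `f ≠ 0`. In general
`c(n) = O(n^k)`. For cusp forms `|f(x + iy)| = O(y^(-k/2))`, so Bessel's inequality on the line
`y = 1 / X` gives `∑_{n ≤ X} |c(n)|² = O(X^k)` (`exists_sum_sq_coeff_le`); by the Cauchy–Schwarz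
inequality the twisted `L`-series converge absolutely for `Re s > (k + 1) / 2`, and Deligne's bound
is not required.
-/

namespace RankinConvolution

open UpperHalfPlane CongruenceSubgroup

/-! ### Summation over common divisors -/

section Summation

/-- Triples `(d, m, n)` of positive integers correspond to pairs with a marked common divisor, via
`(d, m, n) ↦ ((d * m, d * n), d)`. -/
def tripleEquivSigmaDivisors :
    ℕ+ × ℕ+ × ℕ+ ≃ Σ p : ℕ+ × ℕ+, (Nat.gcd p.1 p.2).divisors where
  toFun x := ⟨(x.1 * x.2.1, x.1 * x.2.2), x.1, by
    simp [Nat.gcd_mul_left, (Nat.gcd_pos_of_pos_left _ x.2.1.pos).ne']⟩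
  invFun y :=
    have h := Nat.dvd_gcd_iff.mp (Nat.dvd_of_mem_divisors y.2.2)
    (⟨y.2.1, Nat.pos_of_mem_divisors y.2.2⟩,
      ⟨y.1.1 / y.2.1, Nat.div_pos (Nat.le_of_dvd y.1.1.pos h.1) (Nat.pos_of_mem_divisors y.2.2)⟩,
      ⟨y.1.2 / y.2.1, Nat.div_pos (Nat.le_of_dvd y.1.2.pos h.2) (Nat.pos_of_mem_divisors y.2.2)⟩)
  left_inv x := by
    refine Prod.ext rfl (Prod.ext ?_ ?_) <;> apply PNat.eq <;> simp
  right_inv y := by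
    obtain ⟨⟨m, n⟩, d, hd⟩ := y
    have h := Nat.dvd_gcd_iff.mp (Nat.dvd_of_mem_divisors hd)
    have h1 : (⟨d, Nat.pos_of_mem_divisors hd⟩ : ℕ+) * ⟨m / d, Nat.div_pos
        (Nat.le_of_dvd m.pos h.1) (Nat.pos_of_mem_divisors hd)⟩ = m :=
      PNat.eq (Nat.mul_div_cancel' h.1)
    have h2 : (⟨d, Nat.pos_of_mem_divisors hd⟩ : ℕ+) * ⟨n / d, Nat.div_pos
        (Nat.le_of_dvd n.pos h.2) (Nat.pos_of_mem_divisors hd)⟩ = n :=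
      PNat.eq (Nat.mul_div_cancel' h.2)
    refine Sigma.ext (Prod.ext h1 h2) ?_
    dsimp only
    rw [Subtype.heq_iff_coe_eq]
    · rfl
    · intro x
      change x ∈ (Nat.gcd (d * (m / d)) (d * (n / d))).divisors ↔ x ∈ (Nat.gcd m n).divisors
      rw [Nat.mul_div_cancel' h.1, Nat.mul_div_cancel' h.2]

lemma hasSum_sum_divisors_gcd {G : ℕ → ℕ → ℕ → ℂ} {S : ℂ}
    (h : HasSum (fun x : ℕ+ × ℕ+ × ℕ+ ↦ G x.1 x.2.1 x.2.2) S) :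
    HasSum (fun p : ℕ+ × ℕ+ ↦ ∑ d ∈ (Nat.gcd p.1 p.2).divisors, G d (p.1 / d) (p.2 / d)) S := by
  rw [← tripleEquivSigmaDivisors.symm.hasSum_iff] at h
  refine h.sigma fun p ↦ ?_
  rw [← Finset.sum_coe_sort]
  exact hasSum_fintype _

lemma hasSum_sum_divisorsAntidiagonal {H : ℕ → ℕ → ℂ} {S : ℂ}
    (h : HasSum (fun p : ℕ+ × ℕ+ ↦ H p.1 p.2) S) :
    HasSum (fun n : ℕ+ ↦ ∑ x ∈ (n : ℕ).divisorsAntidiagonal, H x.1 x.2) S := by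
  have h' : HasSum (fun y : Σ n : ℕ+, (n : ℕ).divisorsAntidiagonal ↦ H y.2.1.1 y.2.1.2) S :=
    sigmaAntidiagonalEquivProd.hasSum_iff.mpr h
  refine h'.sigma fun n ↦ ?_
  rw [← Finset.sum_coe_sort]
  exact hasSum_fintype fun x : (n : ℕ).divisorsAntidiagonal ↦ H x.1.1 x.1.2

lemma hasSum_mul_prod {ι κ : Type*} (u : ι → ℂ) (v : κ → ℂ) (hu : Summable u) (hv : Summable v) :
    HasSum (fun x : ι × κ ↦ u x.1 * v x.2) ((∑' i, u i) * ∑' j, v j) :=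
  hu.hasSum.mul hv.hasSum (summable_mul_of_summable_norm hu.norm hv.norm)

end Summation

/-! ### Sequences satisfying the Hecke relations -/

section HeckeRelations

variable {c : ℕ → ℂ} {ψ : ℕ →* ℂ}

/-- The relations `c(m) c(n) = ∑_{d ∣ (m, n)} ψ(d) c(mn / d²)` between the Hecke eigenvalues of an
eigenform; in weight `k` and character `χ` one has `ψ(d) = χ(d) d^(k - 1)`. -/
def HeckeRelation (c : ℕ → ℂ) (ψ : ℕ →* ℂ) : Prop :=
  ∀ m n : ℕ, 0 < m → 0 < n →
    c m * c n = ∑ d ∈ (m.gcd n).divisors, ψ d * c ((m / d) * (n / d))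

/-- The Möbius inversion of the Hecke relations. It bounds `c(mn)` by products of the values of `c`,
which is where the absolute convergence of the double series `∑ α(m) β(n) c(mn)` comes from. -/
lemma HeckeRelation.apply_mul (h : HeckeRelation c ψ) {m n : ℕ} (hm : 0 < m) (hn : 0 < n) :
    c (m * n) = ∑ d ∈ (m.gcd n).divisors,
      (ArithmeticFunction.moebius d : ℂ) * ψ d * (c (m / d) * c (n / d)) := by
  have hg : m.gcd n ≠ 0 := (Nat.gcd_pos_of_pos_left _ hm).ne'
  have key : ∀ d ∈ (m.gcd n).divisors,
      (ArithmeticFunction.moebius d : ℂ) * ψ d * (c (m / d) * c (n / d)) =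
      ∑ e ∈ (m.gcd n / d).divisors, (ArithmeticFunction.moebius d : ℂ) *
        (ψ (d * e) * c ((m / (d * e)) * (n / (d * e)))) := by
    intro d hd
    have hdg := Nat.dvd_of_mem_divisors hd
    have hd0 := Nat.pos_of_mem_divisors hd
    obtain ⟨hdm, hdn⟩ := Nat.dvd_gcd_iff.mp hdg
    rw [h _ _ (Nat.div_pos (Nat.le_of_dvd hm hdm) hd0) (Nat.div_pos (Nat.le_of_dvd hn hdn) hd0),
      Nat.gcd_div hdm hdn, Finset.mul_sum]
    refine Finset.sum_congr rfl fun e _ ↦ ?_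
    rw [map_mul, Nat.div_div_eq_div_mul, Nat.div_div_eq_div_mul]
    ring
  have hmu (g : ℕ) : ∑ d ∈ g.divisors, (ArithmeticFunction.moebius d : ℂ) =
      if g = 1 then 1 else 0 := by
    have := congr_arg (fun F ↦ F g) ArithmeticFunction.coe_zeta_mul_moebius
    simp only [ArithmeticFunction.coe_zeta_mul_apply, ArithmeticFunction.one_apply] at this
    exact_mod_cast this
  rw [Finset.sum_congr rfl key]
  -- collect the terms with a fixed product `g = d * e`; the inner sum of `μ` leaves only `g = 1`
  have swap : ∑ d ∈ (m.gcd n).divisors, ∑ e ∈ (m.gcd n / d).divisors,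
        (ArithmeticFunction.moebius d : ℂ) * (ψ (d * e) * c ((m / (d * e)) * (n / (d * e)))) =
      ∑ g ∈ (m.gcd n).divisors, ∑ d ∈ g.divisors,
        (ArithmeticFunction.moebius d : ℂ) * (ψ g * c ((m / g) * (n / g))) := by
    rw [Finset.sum_sigma', Finset.sum_sigma']
    refine Finset.sum_bij' (fun x _ ↦ ⟨x.1 * x.2, x.1⟩) (fun y _ ↦ ⟨y.2, y.1 / y.2⟩) ?_ ?_ ?_ ?_ ?_
    · rintro ⟨d, e⟩ hx
      simp only [Finset.mem_sigma, Nat.mem_divisors] at hx ⊢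
      have hd0 : d ≠ 0 := fun h0 ↦ hx.1.2 (by simpa [h0] using hx.1.1)
      have he0 : e ≠ 0 := fun h0 ↦ hx.2.2 (by simpa [h0] using hx.2.1)
      exact ⟨⟨(Nat.dvd_div_iff_mul_dvd hx.1.1).mp hx.2.1, hg⟩, Nat.dvd_mul_right d e,
        mul_ne_zero hd0 he0⟩
    · rintro ⟨g, d⟩ hy
      simp only [Finset.mem_sigma, Nat.mem_divisors] at hy ⊢
      have hdg := hy.2.1.trans hy.1.1
      exact ⟨⟨hdg, hg⟩, Nat.div_dvd_div hy.2.1 hy.1.1,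
        (Nat.div_pos (Nat.le_of_dvd (Nat.pos_of_ne_zero hg) hdg)
          (Nat.pos_of_dvd_of_pos hdg (Nat.pos_of_ne_zero hg))).ne'⟩
    · rintro ⟨d, e⟩ hx
      simp only [Finset.mem_sigma] at hx
      simp [Nat.mul_div_cancel_left _ (Nat.pos_of_mem_divisors hx.1)]
    · rintro ⟨g, d⟩ hy
      simp only [Finset.mem_sigma] at hy
      simp [Nat.mul_div_cancel' (Nat.dvd_of_mem_divisors hy.2)]
    · rintro ⟨d, e⟩ _
      rfl
  rw [swap]
  simp_rw [← Finset.sum_mul, hmu]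
  simp [hg]

/-- The product decomposition for an arbitrary sequence with Hecke relations. Both sides of the
final identity sum `ψ(d) α(dm) β(dn) c(mn)` over all triples `(d, m, n)`. -/
theorem HeckeRelation.exists_hasSum (h : HeckeRelation c ψ) (α β : ℕ →* ℂ)
    (hα : Summable fun n : ℕ+ ↦ α n * c n) (hβ : Summable fun n : ℕ+ ↦ β n * c n)
    (hψ : Summable fun n : ℕ+ ↦ ψ n * α n * β n) :
    ∃ S : ℂ, HasSum (fun n : ℕ+ ↦ (∑ x ∈ (n : ℕ).divisorsAntidiagonal, α x.1 * β x.2) * c n) S ∧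
      (∑' n : ℕ+, ψ n * α n * β n) * S = (∑' n : ℕ+, α n * c n) * ∑' n : ℕ+, β n * c n := by
  have hdvd {p : ℕ+ × ℕ+} {d : ℕ} (hd : d ∈ (Nat.gcd p.1 p.2).divisors) :
      α p.1 = α d * α (p.1 / d) ∧ β p.2 = β d * β (p.2 / d) := by
    obtain ⟨h1, h2⟩ := Nat.dvd_gcd_iff.mp (Nat.dvd_of_mem_divisors hd)
    rw [← map_mul, ← map_mul, Nat.mul_div_cancel' h1, Nat.mul_div_cancel' h2]
    exact ⟨rfl, rfl⟩
  have hsum : Summable fun p : ℕ+ × ℕ+ ↦ α p.1 * β p.2 * c (p.1 * p.2) := by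
    have hμ : Summable fun n : ℕ+ ↦
        (ArithmeticFunction.moebius n : ℂ) * (ψ n * α n * β n) := by
      refine .of_norm_bounded hψ.norm fun n ↦ ?_
      rw [norm_mul]
      refine mul_le_of_le_one_left (norm_nonneg _) ?_
      rw [Complex.norm_intCast]
      exact_mod_cast ArithmeticFunction.abs_moebius_le_one
    have h2 := hasSum_mul_prod (fun n : ℕ+ ↦ α n * c n) (fun n : ℕ+ ↦ β n * c n) hα hβ
    have h3 := hasSum_mul_prod (fun n : ℕ+ ↦ (ArithmeticFunction.moebius n : ℂ) *
      (ψ n * α n * β n)) (fun x : ℕ+ × ℕ+ ↦ α x.1 * c x.1 * (β x.2 * c x.2)) hμ h2.summable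
    have := hasSum_sum_divisors_gcd (G := fun d m n ↦
      (ArithmeticFunction.moebius d : ℂ) * (ψ d * α d * β d) * (α m * c m * (β n * c n))) h3
    refine this.summable.congr fun p ↦ ?_
    rw [h.apply_mul p.1.pos p.2.pos, Finset.mul_sum]
    refine Finset.sum_congr rfl fun d hd ↦ ?_
    rw [(hdvd hd).1, (hdvd hd).2]
    ring
  have hS := hasSum_sum_divisorsAntidiagonal (H := fun m n ↦ α m * β n * c (m * n)) hsum.hasSum
  refine ⟨_, hS.congr_fun ?_, ?_⟩
  · intro n
    rw [Finset.sum_mul]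
    refine Finset.sum_congr rfl fun x hx ↦ ?_
    rw [(Nat.mem_divisorsAntidiagonal.mp hx).1]
  · have h3 := hasSum_sum_divisors_gcd (G := fun d m n ↦
      (ψ d * α d * β d) * (α m * β n * c (m * n)))
      (hasSum_mul_prod (fun n : ℕ+ ↦ ψ n * α n * β n)
        (fun p : ℕ+ × ℕ+ ↦ α p.1 * β p.2 * c (p.1 * p.2)) hψ hsum)
    have h4 := hasSum_mul_prod (fun n : ℕ+ ↦ α n * c n) (fun n : ℕ+ ↦ β n * c n) hα hβ
    refine h3.unique (h4.congr_fun ?_)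
    intro p
    rw [mul_mul_mul_comm, h _ _ p.1.pos p.2.pos, Finset.mul_sum]
    refine Finset.sum_congr rfl fun d hd ↦ ?_
    rw [(hdvd hd).1, (hdvd hd).2]
    ring

end HeckeRelations

/-! ### Hecke operators on Fourier expansions -/

section HeckeOperators

local notation "𝕢" => Function.Periodic.qParam

variable {N : ℕ} {k : ℤ}

lemma hasSum_coeff (f : ModularForm (Γ₁ N) k) (τ : ℍ) :
    HasSum (fun m ↦ coeff f m * 𝕢 1 τ ^ m) (f τ) :=
  have h1 : (1 : ℝ) ∈ (Γ₁ N).strictPeriods := by simp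
  have : Fact (IsCusp OnePoint.infty (Γ₁ N)) :=
    ⟨(Γ₁ N).isCusp_of_mem_strictPeriods one_pos h1⟩
  ModularForm.hasSum_qExpansion f one_pos h1 τ

/-- Orthogonality of the additive characters modulo `d`. -/
lemma sum_qParam_pow (d : ℕ) [NeZero d] (m : ℕ) :
    ∑ b ∈ Finset.range d, 𝕢 1 ((b : ℂ) / d) ^ m = if d ∣ m then (d : ℂ) else 0 := by
  have hd : (d : ℂ) ≠ 0 := NeZero.ne _
  set ζ : ℂ := Complex.exp (2 * Real.pi * Complex.I / d) with hζ
  have hprim : IsPrimitiveRoot ζ d := Complex.isPrimitiveRoot_exp d (NeZero.ne d)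
  have h1 (b : ℕ) : 𝕢 1 ((b : ℂ) / d) ^ m = (ζ ^ m) ^ b := by
    rw [Function.Periodic.qParam, hζ, ← Complex.exp_nat_mul, ← Complex.exp_nat_mul,
      ← Complex.exp_nat_mul]
    congr 1
    push_cast
    ring
  simp_rw [h1]
  split_ifs with hdm
  · simp [(hprim.pow_eq_one_iff_dvd m).mpr hdm]
  · have hne : ζ ^ m ≠ 1 := fun h ↦ hdm ((hprim.pow_eq_one_iff_dvd m).mp h)
    rw [geom_sum_eq hne, ← pow_mul, mul_comm m d, pow_mul, hprim.pow_eq_one]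
    simp

/-- Averaging over the translates `(aτ + b) / d` keeps the coefficients with index divisible
by `d`. -/
lemma hasSum_sum_translates (f : ModularForm (Γ₁ N) k) {a d : ℕ} (ha : 0 < a) (hd : 0 < d)
    (τ : ℍ) :
    HasSum (fun m ↦ (if a ∣ m then (d : ℂ) * coeff f (d * (m / a)) else 0) * 𝕢 1 τ ^ m)
      (∑ b ∈ Finset.range d, f (ofComplex (((a : ℂ) * τ + b) / d))) := by
  have : NeZero d := ⟨hd.ne'⟩
  have hdC : (d : ℂ) ≠ 0 := NeZero.ne _
  have him (b : ℕ) : 0 < (((a : ℂ) * τ + b) / d).im := by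
    have : (((a : ℂ) * τ + b) / d).im = a * τ.im / d := by simp [Complex.div_natCast_im]
    rw [this]
    have := τ.im_pos
    positivity
  have h1 : HasSum (fun m ↦ ∑ b ∈ Finset.range d, coeff f m * 𝕢 1 (((a : ℂ) * τ + b) / d) ^ m)
      (∑ b ∈ Finset.range d, f (ofComplex (((a : ℂ) * τ + b) / d))) := by
    refine hasSum_sum fun b _ ↦ ?_
    have := hasSum_coeff f (ofComplex (((a : ℂ) * τ + b) / d))
    rwa [ofComplex_apply_of_im_pos (him b)] at this ⊢
  have h2 (m : ℕ) : ∑ b ∈ Finset.range d, coeff f m * 𝕢 1 (((a : ℂ) * τ + b) / d) ^ m =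
      if d ∣ m then (d : ℂ) * coeff f m * 𝕢 1 ((a : ℂ) * τ / d) ^ m else 0 := by
    have h3 (b : ℕ) : 𝕢 1 (((a : ℂ) * τ + b) / d) = 𝕢 1 ((a : ℂ) * τ / d) * 𝕢 1 ((b : ℂ) / d) := by
      simp only [Function.Periodic.qParam]
      rw [← Complex.exp_add]
      congr 1
      push_cast
      ring
    simp_rw [h3, mul_pow, ← mul_assoc, ← Finset.mul_sum, sum_qParam_pow]
    split_ifs <;> ring
  simp_rw [h2] at h1
  -- the surviving indices are `d * t`, and the `t`-th of them contributes to the exponent `a * t`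
  have hdinj : Function.Injective fun t : ℕ ↦ d * t := fun _ _ h ↦ Nat.eq_of_mul_eq_mul_left hd h
  have hainj : Function.Injective fun t : ℕ ↦ a * t := fun _ _ h ↦ Nat.eq_of_mul_eq_mul_left ha h
  rw [← hdinj.hasSum_iff] at h1
  · rw [← hainj.hasSum_iff]
    · refine h1.congr_fun fun t ↦ ?_
      simp only [Function.comp_apply, dvd_mul_right, if_true, Nat.mul_div_cancel_left _ ha]
      congr 1
      simp only [Function.Periodic.qParam]
      rw [← Complex.exp_nat_mul, ← Complex.exp_nat_mul]
      congr 1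
      push_cast
      field_simp
    · intro m hm
      have : ¬ a ∣ m := fun ⟨t, ht⟩ ↦ hm ⟨t, ht.symm⟩
      simp [this]
  · intro m hm
    have : ¬ d ∣ m := fun ⟨t, ht⟩ ↦ hm ⟨t, ht.symm⟩
    simp [this]

/-- The Fourier expansion of `T_n f`. -/
lemma hasSum_heckeT (χ : DirichletCharacter ℂ N) (f : ModularForm (Γ₁ N) k) (n : ℕ)
    (τ : ℍ) :
    HasSum (fun m ↦ (∑ ad ∈ n.divisorsAntidiagonal, if ad.1 ∣ m then
        χ (ad.1 : ZMod N) * (ad.1 : ℂ) ^ (k - 1) * coeff f (ad.2 * (m / ad.1)) else 0) * 𝕢 1 τ ^ m)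
      (heckeT k χ n f τ) := by
  have h1 : HasSum (fun m ↦ (n : ℂ) ^ (k - 1) * ∑ ad ∈ n.divisorsAntidiagonal,
      χ (ad.1 : ZMod N) * (ad.2 : ℂ) ^ (-k) * ((if ad.1 ∣ m then
        (ad.2 : ℂ) * coeff f (ad.2 * (m / ad.1)) else 0) * 𝕢 1 τ ^ m)) (heckeT k χ n f τ) := by
    refine (hasSum_sum fun ad had ↦ ?_).mul_left _
    have hpos := Nat.mem_divisorsAntidiagonal.mp had
    exact (hasSum_sum_translates f
      (Nat.pos_of_ne_zero fun h ↦ hpos.2 (by rw [← hpos.1, h, zero_mul]))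
      (Nat.pos_of_ne_zero fun h ↦ hpos.2 (by rw [← hpos.1, h, mul_zero])) τ).mul_left _
  refine h1.congr_fun fun m ↦ ?_
  rw [Finset.sum_mul, Finset.mul_sum]
  refine Finset.sum_congr rfl fun ad had ↦ ?_
  obtain ⟨hprod, hn0⟩ := Nat.mem_divisorsAntidiagonal.mp had
  split_ifs with hdvd
  · have ha : (ad.1 : ℂ) ≠ 0 := by
      rintro h
      exact hn0 (by rw [← hprod, Nat.cast_eq_zero.mp h, zero_mul])
    have hd : (ad.2 : ℂ) ≠ 0 := by
      rintro h
      exact hn0 (by rw [← hprod, Nat.cast_eq_zero.mp h, mul_zero])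
    have hpow : (n : ℂ) ^ (k - 1) * (ad.2 : ℂ) ^ (-k) * ad.2 = (ad.1 : ℂ) ^ (k - 1) := by
      rw [← hprod, Nat.cast_mul, mul_zpow, mul_assoc, mul_assoc, ← zpow_add_one₀ hd,
        ← zpow_add₀ hd]
      simp
    rw [← hpow]
    ring
  · simp

lemma coeff_unique {F : ℍ → ℂ} (hF : AnalyticAt ℂ (cuspFunction 1 F) 0) {b c : ℕ → ℂ}
    (hb : ∀ τ : ℍ, HasSum (fun m ↦ b m * 𝕢 1 τ ^ m) (F τ))
    (hc : ∀ τ : ℍ, HasSum (fun m ↦ c m * 𝕢 1 τ ^ m) (F τ)) : b = c := by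
  have h1 := hasFPowerSeriesOnBall_cuspFunction one_pos hF hb
  have h2 := hasFPowerSeriesOnBall_cuspFunction one_pos hF hc
  have := h1.hasFPowerSeriesAt.eq_formalMultilinearSeries h2.hasFPowerSeriesAt
  exact FormalMultilinearSeries.ofScalars_series_injective ℂ ℂ this

/-- The completely multiplicative function `d ↦ χ(d) d^(k - 1)`. -/
noncomputable def heckeWeight (k : ℤ) (χ : DirichletCharacter ℂ N) : ℕ →* ℂ where
  toFun d := χ (d : ZMod N) * (d : ℂ) ^ (k - 1)
  map_one' := by simp
  map_mul' m n := by
    push_cast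
    rw [map_mul, mul_zpow]
    ring

lemma IsNormalizedEigenform.heckeRelation {χ : DirichletCharacter ℂ N} {f : ModularForm (Γ₁ N) k}
    (hf : IsNormalizedEigenform χ f) : HeckeRelation (coeff f) (heckeWeight k χ) := by
  intro m n hm hn
  obtain ⟨A, hA⟩ := hf.eigen m hm
  have h1 : (1 : ℝ) ∈ (Γ₁ N).strictPeriods := by simp
  have han : AnalyticAt ℂ (cuspFunction 1 (A • ⇑f)) 0 := by
    rw [ModularForm.cuspFunction_smul one_pos h1 A f]
    exact (ModularFormClass.analyticAt_cuspFunction_zero f one_pos h1).const_smul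
  have key := coeff_unique han (fun τ ↦ hA ▸ hasSum_heckeT χ f m τ)
    (c := fun j ↦ A * coeff f j) fun τ ↦ by
      simpa [mul_assoc] using (hasSum_coeff f τ).mul_left A
  -- the first coefficient identifies the eigenvalue of `T_m` with `c(m)`
  have hAm : A = coeff f m := by
    have := congr_fun key 1
    simp only [hf.normalized, mul_one, Nat.dvd_one] at this
    rw [← this, Finset.sum_eq_single_of_mem (1, m) (by simp [hm.ne'])]
    · simp
    · rintro ⟨a, d⟩ had hne
      rw [if_neg]
      rintro rfl
      exact hne (by simpa using (Nat.mem_divisorsAntidiagonal.mp had).1)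
  have := congr_fun key n
  rw [← hAm, ← this, Nat.sum_divisorsAntidiagonal (f := fun a d ↦ if a ∣ n then
    χ (a : ZMod N) * (a : ℂ) ^ (k - 1) * coeff f (d * (n / a)) else 0), ← Finset.sum_filter]
  refine Finset.sum_congr ?_ fun _ _ ↦ rfl
  ext d
  simp [Nat.dvd_gcd_iff, hm.ne', (Nat.gcd_pos_of_pos_left n hm).ne']

end HeckeOperators

/-! ### Growth of Fourier coefficients -/

section Growth

local notation "𝕢" => Function.Periodic.qParam

open MeasureTheory Asymptotics Filter in
/-- Bessel's inequality for the restriction of `f` to the horizontal line of height `t`. -/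
lemma sum_sq_coeff_mul_exp_le {N : ℕ} {k : ℤ} (f : ModularForm (Γ₁ N) k) {t B : ℝ} (ht : 0 < t)
    (hB : ∀ τ : ℍ, τ.im = t → ‖f τ‖ ≤ B) (s : Finset ℕ) :
    ∑ n ∈ s, (‖coeff f n‖ * Real.exp (-2 * Real.pi * n * t)) ^ 2 ≤ B ^ 2 := by
  have h1 : (1 : ℝ) ∈ (Γ₁ N).strictPeriods := by simp
  let g : ℝ → ℂ := fun x ↦ f ⟨x + t * Complex.I, by simpa using ht⟩
  have hg : Continuous g := by
    refine (ModularFormClass.holo f).continuous.comp ?_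
    exact continuous_induced_rng.mpr (by fun_prop)
  have hgB (x : ℝ) : ‖g x‖ ≤ B := hB _ (by simp [← UpperHalfPlane.coe_im])
  have hL2 : MemLp g 2 (volume.restrict (Set.Ioc 0 1)) :=
    MemLp.of_bound hg.aestronglyMeasurable B (ae_of_all _ hgB)
  -- `c(n) exp(-2πnt)` is the `n`-th Fourier coefficient of `x ↦ f(x + it)` on `[0, 1]`
  have hcoeff (n : ℕ) : ‖coeff f n‖ * Real.exp (-2 * Real.pi * n * t) =
      ‖fourierCoeffOn (zero_lt_one' ℝ) g n‖ := by
    have key : fourierCoeffOn (zero_lt_one' ℝ) g n =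
        Complex.exp (-2 * Real.pi * n * t) * coeff f n := by
      rw [coeff, ModularFormClass.qExpansion_coeff_eq_intervalIntegral f one_pos h1 n ht,
        fourierCoeffOn_eq_integral]
      simp only [sub_zero, div_one, one_smul, Complex.ofReal_one, one_mul]
      rw [← intervalIntegral.integral_const_mul]
      refine intervalIntegral.integral_congr fun x _ ↦ ?_
      simp only [fourier_coe_apply, smul_eq_mul, g, ← mul_assoc]
      congr 1
      simp only [Function.Periodic.qParam]
      rw [← Complex.exp_nat_mul, one_div, ← Complex.exp_neg, ← Complex.exp_add]
      congr 1
      push_cast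
      ring_nf
      rw [Complex.I_sq]
      ring
    rw [key, norm_mul, Complex.norm_exp, mul_comm]
    congr 2
    norm_cast
  have hparseval := hasSum_sq_fourierCoeffOn (zero_lt_one' ℝ) hL2
  calc ∑ n ∈ s, (‖coeff f n‖ * Real.exp (-2 * Real.pi * n * t)) ^ 2
      = ∑ m ∈ s.map Nat.castEmbedding, ‖fourierCoeffOn (zero_lt_one' ℝ) g m‖ ^ 2 := by
        rw [Finset.sum_map]
        exact Finset.sum_congr rfl fun n _ ↦ by rw [hcoeff]; rfl
    _ ≤ (1 - 0 : ℝ)⁻¹ • ∫ x in (0 : ℝ)..1, ‖g x‖ ^ 2 :=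
        sum_le_hasSum _ (fun _ _ ↦ by positivity) hparseval
    _ ≤ ∫ x in (0 : ℝ)..1, B ^ 2 := by
        simp only [sub_zero, inv_one, one_smul]
        refine intervalIntegral.integral_mono_on zero_le_one
          (Continuous.intervalIntegrable (by fun_prop) _ _) (by simp) fun x _ ↦ ?_
        gcongr
        exact hgB x
    _ = B ^ 2 := by simp

lemma norm_twistCoeff_le {N D : ℕ} {k : ℤ} (f : ModularForm (Γ₁ N) k)
    (ψ : DirichletCharacter ℂ D) (n : ℕ) :
    ‖twistCoeff f ψ n‖ ≤ ‖coeff f n‖ := by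
  rw [twistCoeff, norm_mul]
  exact mul_le_of_le_one_left (norm_nonneg _) (ψ.norm_le_one _)

variable {N : ℕ} [NeZero N] {k : ℤ}

/-- Rankin's mean square bound, read off from the line of height `1 / X`. -/
lemma exists_sum_sq_coeff_le {f : ModularForm (Γ₁ N) k}
    (hf : f ∈ ModularForm.cuspFormSubmodule (Γ₁ N) k) :
    ∃ C : ℝ, 0 ≤ C ∧ ∀ X : ℕ, 0 < X → ∑ n ∈ Finset.Icc 1 X, ‖coeff f n‖ ^ 2 ≤ C * (X : ℝ) ^ k := by
  obtain ⟨g, rfl⟩ := hf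
  obtain ⟨C, hC⟩ := CuspFormClass.exists_bound g
  refine ⟨C ^ 2 * Real.exp (2 * Real.pi) ^ 2, by positivity, fun X hX ↦ ?_⟩
  have hX' : (0 : ℝ) < X := by exact_mod_cast hX
  have hsum := sum_sq_coeff_mul_exp_le (CuspForm.toModularFormₗ g) (t := 1 / X)
    (B := C / (1 / X : ℝ) ^ (k / 2 : ℝ)) (by positivity) (fun τ hτ ↦ by
      rw [← hτ]; exact hC τ) (Finset.Icc 1 X)
  have hB : (C / (1 / X : ℝ) ^ (k / 2 : ℝ)) ^ 2 = C ^ 2 * (X : ℝ) ^ k := by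
    rw [div_pow, ← Real.rpow_mul_natCast (by positivity), one_div, Real.inv_rpow hX'.le,
      div_inv_eq_mul, Nat.cast_ofNat, div_mul_cancel₀ _ two_ne_zero, Real.rpow_intCast]
  calc ∑ n ∈ Finset.Icc 1 X, ‖coeff (CuspForm.toModularFormₗ g) n‖ ^ 2
      ≤ ∑ n ∈ Finset.Icc 1 X, (‖coeff (CuspForm.toModularFormₗ g) n‖ *
          Real.exp (-2 * Real.pi * n * (1 / X))) ^ 2 * Real.exp (2 * Real.pi) ^ 2 := by
        refine Finset.sum_le_sum fun n hn ↦ ?_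
        rw [← mul_pow, mul_assoc, ← Real.exp_add]
        gcongr
        refine le_mul_of_one_le_right (norm_nonneg _) (Real.one_le_exp ?_)
        have hle : (n : ℝ) ≤ X := by exact_mod_cast (Finset.mem_Icc.mp hn).2
        have h1 : (n : ℝ) * (1 / X) ≤ 1 := by rwa [mul_one_div, div_le_one hX']
        nlinarith [Real.pi_pos]
    _ ≤ C ^ 2 * (X : ℝ) ^ k * Real.exp (2 * Real.pi) ^ 2 := by
        rw [← Finset.sum_mul, ← hB]
        gcongr
    _ = _ := by ring

open Asymptotics Filter in
/-- The twists of a cusp form converge absolutely to the right of `(k + 1) / 2`: by the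
Cauchy–Schwarz inequality, the mean square bound gives `∑_{n ≤ X} |c(n)| = O(X^((k + 1) / 2))`. -/
lemma lseriesSummable_twistCoeff_of_cuspidal {D : ℕ} (hk : 0 ≤ k) {f : ModularForm (Γ₁ N) k}
    (hf : f ∈ ModularForm.cuspFormSubmodule (Γ₁ N) k) (ψ : DirichletCharacter ℂ D) {s : ℂ}
    (hs : ((k : ℝ) + 1) / 2 < s.re) : LSeriesSummable (twistCoeff f ψ) s := by
  have hk' : (0 : ℝ) ≤ k := by exact_mod_cast hk
  obtain ⟨C, hC0, hC⟩ := exists_sum_sq_coeff_le hf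
  refine LSeriesSummable_of_sum_norm_bigO (r := ((k : ℝ) + 1) / 2) ?_ (by positivity) hs
  refine IsBigO.of_bound (√C) ?_
  filter_upwards [eventually_gt_atTop 0] with X hX
  have hX' : (0 : ℝ) < X := by exact_mod_cast hX
  rw [Real.norm_of_nonneg (by positivity), Real.norm_of_nonneg (by positivity)]
  refine le_of_sq_le_sq ?_ (by positivity)
  calc (∑ n ∈ Finset.Icc 1 X, ‖twistCoeff f ψ n‖) ^ 2
      ≤ (∑ n ∈ Finset.Icc 1 X, ‖coeff f n‖) ^ 2 := by
        gcongr with n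
        exact norm_twistCoeff_le f ψ n
    _ ≤ X * ∑ n ∈ Finset.Icc 1 X, ‖coeff f n‖ ^ 2 := by
        simpa using sq_sum_le_card_mul_sum_sq (s := Finset.Icc 1 X) (f := fun n ↦ ‖coeff f n‖)
    _ ≤ X * (C * (X : ℝ) ^ k) := by gcongr; exact hC X hX
    _ = (√C * (X : ℝ) ^ (((k : ℝ) + 1) / 2)) ^ 2 := by
        rw [mul_pow, Real.sq_sqrt hC0, ← Real.rpow_mul_natCast hX'.le, Nat.cast_ofNat,
          div_mul_cancel₀ _ two_ne_zero, Real.rpow_add_one hX'.ne', Real.rpow_intCast]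
        ring

open Asymptotics Filter in
lemma lseriesSummable_twistCoeff {D : ℕ} (hk : 0 ≤ k) (f : ModularForm (Γ₁ N) k)
    (ψ : DirichletCharacter ℂ D) {s : ℂ} (hs : (k : ℝ) + 1 < s.re) :
    LSeriesSummable (twistCoeff f ψ) s := by
  have hO := ModularFormClass.qExpansion_isBigO hk f
  have hw : (Γ₁ N).strictWidthInfty = 1 := by simp
  rw [hw] at hO
  refine LSeriesSummable_of_isBigO_rpow hs ?_
  simp only [add_sub_cancel_right, Real.rpow_intCast]
  exact (isBigO_of_le _ fun n ↦ norm_twistCoeff_le f ψ n).trans hO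

lemma IsNormalizedEigenform.weight_nonneg {χ : DirichletCharacter ℂ N} {f : ModularForm (Γ₁ N) k}
    (hf : IsNormalizedEigenform χ f) : 0 ≤ k := by
  by_contra! hk
  have h0 : f = 0 := ModularForm.isZero_of_neg_weight hk f
  have := hf.normalized
  rw [h0, coeff, FunLike.coe_zero, qExpansion_zero] at this
  simp at this

end Growth

/-! ### The product decomposition -/

section Decomposition

lemma prodChar_apply {N D E : ℕ} (χ : DirichletCharacter ℂ N) (δ : DirichletCharacter ℂ D)
    (ε : DirichletCharacter ℂ E) (n : ℕ) : prodChar χ δ ε n = χ n * δ n * ε n := by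
  have mul_natCast {A B : ℕ} (φ : DirichletCharacter ℂ A) (θ : DirichletCharacter ℂ B) :
      φ.mul θ (n : ZMod (A.lcm B)) = φ n * θ n := by
    by_cases hn : n.Coprime (A.lcm B)
    · have hu : IsCoprime (n : ℤ) (A.lcm B : ℕ) := Nat.isCoprime_iff_coprime.mpr hn
      have h1 := φ.changeLevel_eq_cast_of_dvd' (Nat.dvd_lcm_left A B) hu
      have h2 := θ.changeLevel_eq_cast_of_dvd' (Nat.dvd_lcm_right A B) hu
      rw [Int.cast_natCast, Int.cast_natCast] at h1 h2
      rw [DirichletCharacter.mul, MulChar.mul_apply, h1, h2]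
    · have h0 : ¬ (n.Coprime A ∧ n.Coprime B) := fun h ↦
        hn ((h.1.mul_right h.2).coprime_dvd_right (Nat.lcm_dvd_mul A B))
      rw [MulChar.map_nonunit _ (mt (ZMod.isUnit_iff_coprime _ _).mp hn)]
      rcases not_and_or.mp h0 with h | h
      · rw [φ.map_nonunit (mt (ZMod.isUnit_iff_coprime _ _).mp h), zero_mul]
      · rw [θ.map_nonunit (mt (ZMod.isUnit_iff_coprime _ _).mp h), mul_zero]
  rw [prodChar, mul_natCast, mul_natCast]

/-- The completely multiplicative function `n ↦ ψ(n) n^(-s)`. It is multiplicative at `n = 0` too,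
since `0^(-s)` is `0` or, for `s = 0`, equals `1`. -/
noncomputable def charCpow {D : ℕ} (ψ : DirichletCharacter ℂ D) (s : ℂ) : ℕ →* ℂ where
  toFun n := ψ (n : ZMod D) * (n : ℂ) ^ (-s)
  map_one' := by simp
  map_mul' m n := by
    rw [Nat.cast_mul, map_mul, Nat.cast_mul, Complex.natCast_mul_natCast_cpow]
    ring

lemma LSeriesHasSum_iff_pnat {a : ℕ → ℂ} {s S : ℂ} :
    LSeriesHasSum a s S ↔ HasSum (fun n : ℕ+ ↦ a n * (n : ℂ) ^ (-s)) S := by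
  have hinj : Function.Injective ((↑) : ℕ+ → ℕ) := PNat.coe_injective
  rw [LSeriesHasSum, ← hinj.hasSum_iff]
  · refine iff_of_eq (congr_arg (HasSum · S) (funext fun n ↦ ?_))
    rw [Function.comp_apply, LSeries.term_of_ne_zero n.ne_zero, Complex.cpow_neg, div_eq_mul_inv]
  · intro n hn
    have : n = 0 := by
      by_contra h
      exact hn ⟨⟨n, Nat.pos_of_ne_zero h⟩, rfl⟩
    simp [this]

lemma LSeriesSummable.hasSum_pnat {a : ℕ → ℂ} {s : ℂ} (h : LSeriesSummable a s) :
    HasSum (fun n : ℕ+ ↦ a n * (n : ℂ) ^ (-s)) (LSeries a s) :=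
  LSeriesHasSum_iff_pnat.mp h.LSeriesHasSum

/-- The decomposition holds wherever the two twisted `L`-series and the Dirichlet `L`-series
converge absolutely. -/
theorem IsNormalizedEigenform.productDecomposition {N D E : ℕ} {k : ℤ}
    {χ : DirichletCharacter ℂ N} {f : ModularForm (Γ₁ N) k}
    (hf : IsNormalizedEigenform χ f) {δ : DirichletCharacter ℂ D} {ε : DirichletCharacter ℂ E}
    {s w : ℂ} (h1 : LSeriesSummable (twistCoeff f ε) s)
    (h2 : LSeriesSummable (twistCoeff f δ) (s - w)) (h3 : 1 < (2 * s - w + 1 - k).re) :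
    ProductDecomposition χ f δ ε s w := by
  have hden : LSeriesSummable (prodChar χ δ ε) (2 * s - w + 1 - k) :=
    DirichletCharacter.LSeriesSummable_of_one_lt_re _ h3
  have hne : LSeries (prodChar χ δ ε) (2 * s - w + 1 - k) ≠ 0 :=
    DirichletCharacter.LSeries_ne_zero_of_one_lt_re _ h3
  have hα : HasSum (fun n : ℕ+ ↦ charCpow ε s n * coeff f n) (LSeries (twistCoeff f ε) s) :=
    (LSeriesSummable.hasSum_pnat h1).congr_fun fun n ↦ by
      simp only [charCpow, twistCoeff, MonoidHom.coe_mk, OneHom.coe_mk]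
      ring
  have hβ : HasSum (fun n : ℕ+ ↦ charCpow δ (s - w) n * coeff f n)
      (LSeries (twistCoeff f δ) (s - w)) :=
    (LSeriesSummable.hasSum_pnat h2).congr_fun fun n ↦ by
      simp only [charCpow, twistCoeff, MonoidHom.coe_mk, OneHom.coe_mk]
      ring
  have hψ : HasSum (fun n : ℕ+ ↦ heckeWeight k χ n * charCpow ε s n * charCpow δ (s - w) n)
      (LSeries (prodChar χ δ ε) (2 * s - w + 1 - k)) :=
    (LSeriesSummable.hasSum_pnat hden).congr_fun fun n ↦ by
      have hn : ((n : ℕ) : ℂ) ≠ 0 := by exact_mod_cast n.ne_zero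
      have hpow : ((n : ℕ) : ℂ) ^ (-(2 * s - w + 1 - k)) =
          (n : ℂ) ^ (k - 1) * (n : ℂ) ^ (-s) * (n : ℂ) ^ (-(s - w)) := by
        rw [← Complex.cpow_intCast, ← Complex.cpow_add _ _ hn, ← Complex.cpow_add _ _ hn]
        congr 1
        push_cast
        ring
      simp only [charCpow, heckeWeight, prodChar_apply, MonoidHom.coe_mk, OneHom.coe_mk, hpow]
      ring
  obtain ⟨S, hS, hmul⟩ := hf.heckeRelation.exists_hasSum (charCpow ε s) (charCpow δ (s - w))
    hα.summable hβ.summable hψ.summable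
  rw [hα.tsum_eq, hβ.tsum_eq, hψ.tsum_eq] at hmul
  refine ⟨h1, h2, hden, hne, ?_⟩
  rw [← hmul, mul_div_cancel_left₀ _ hne, LSeriesHasSum_iff_pnat]
  refine hS.congr_fun fun n ↦ ?_
  rw [sigma, ← Nat.sum_divisorsAntidiagonal' (f := fun x y ↦
    δ (y : ZMod D) * ε (x : ZMod E) * (y : ℂ) ^ w), mul_right_comm, Finset.sum_mul]
  congr 1
  refine Finset.sum_congr rfl fun x hx ↦ ?_
  obtain ⟨hx, hn⟩ := Nat.mem_divisorsAntidiagonal.mp hx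
  have hy : (x.2 : ℂ) ≠ 0 := by
    rintro h
    exact hn (by rw [← hx, Nat.cast_eq_zero.mp h, mul_zero])
  simp only [charCpow, MonoidHom.coe_mk, OneHom.coe_mk]
  rw [← hx, Nat.cast_mul, Complex.natCast_mul_natCast_cpow, neg_sub, sub_eq_add_neg,
    Complex.cpow_add _ _ hy]
  ring

end Decomposition

end RankinConvolution

theorem mainTheorem11 {N D E : ℕ} [NeZero N] [NeZero D] [NeZero E] {k : ℤ}
    (χ : DirichletCharacter ℂ N) (δ : DirichletCharacter ℂ D) (ε : DirichletCharacter ℂ E)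
    (f : ModularForm (RankinConvolution.Γ₁ N) k) :
    (RankinConvolution.IsNewform χ f → ∀ s w : ℂ,
      w.re + ((k : ℝ) + 3) / 2 < s.re → ((k : ℝ) + 1) / 2 < s.re →
        RankinConvolution.ProductDecomposition χ f δ ε s w) ∧
    (RankinConvolution.IsNormalizedEigenform χ f → ∀ s w : ℂ,
      w.re + (k : ℝ) + 1 < s.re → (k : ℝ) + 1 < s.re →
        RankinConvolution.ProductDecomposition χ f δ ε s w) := by
  have hre (s w : ℂ) : (2 * s - w + 1 - k).re = 2 * s.re - w.re + 1 - k := by simp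
  refine ⟨fun hf s w h1 h2 ↦ ?_, fun hf s w h1 h2 ↦ ?_⟩
  · have hk := hf.weight_nonneg
    refine hf.productDecomposition
      (RankinConvolution.lseriesSummable_twistCoeff_of_cuspidal hk hf.cuspidal.2 ε h2)
      (RankinConvolution.lseriesSummable_twistCoeff_of_cuspidal hk hf.cuspidal.2 δ ?_) ?_
    · rw [Complex.sub_re]
      linarith
    · rw [hre]
      linarith
  · have hk := hf.weight_nonneg
    have hk' : (0 : ℝ) ≤ k := by exact_mod_cast hk
    refine hf.productDecomposition
      (RankinConvolution.lseriesSummable_twistCoeff hk f ε h2)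
      (RankinConvolution.lseriesSummable_twistCoeff hk f δ ?_) ?_
    · rw [Complex.sub_re]
      linarith
    · rw [hre]
      linarith
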